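/- **Theorem 1.3.** Let $\mathbb H=\{z\in\mathbb C:\operatorname{Im} z>0\}$ and write $y=\operatorname{Im} z$. For an even integer $k$ (positive, zero or negative) and $z\in\mathbb H$ put $$V_k(z)=\sum_{m=1}^\infty \sigma_{k-1}(m)\,e^{-2\pi i m\bar z}\sum_{u=0}^{-k}\frac{(4\pi m y)^u}{u!},\qquad \sigma_{s}(m)=\sum_{d\mid m}d^{s},$$ where the inner sum is empty (so $V_k=0$) if $k>0$. Let $B_n$ be the Bernoulli numbers, $\zeta$ the Riemann zeta function (analytically continued), and $\log$ the principal branch of the logarithm. Then for all $k\in 2\mathbb Z$ and all $z\in\mathbb H$ the series $V_k(z)$ and $V_k(-1/z)$ converge absolutely and $$2\left(z^kV_k(z)-V_k(-1/z)\right)=\frac{2\zeta(2-k)}{(2\pi i)^k}\left(\frac y\pi\right)^{1-k}\left(|z|^{2k-2}-z^k\right)-(2\pi i)^{1-k}\sum_{\substack{u,v\in\mathbb Z_{\ge 0}\\ u+v=1-k/2}}\frac{B_{2u}}{(2u)!}\frac{B_{2v}}{(2v)!}\,z^{1-2v}+C_k(z),$$ where the sum over $u,v$ is empty (equal to $0$)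 if $k>2$, and $$C_k(z)=\begin{cases}0&\text{if }k>0,\\[2pt] \dfrac{\pi i}{2}+\overline{\log z}&\text{if }k=0,\\[2pt] (1-z^k)\,\zeta(1-k)&\text{if }k<0.\end{cases}$$ -/

import Mathlib

open scoped ComplexConjugate

/-- The divisor function `σ_s(m) = ∑_{d ∣ m} d ^ s` with an integer exponent `s`,
possibly negative. -/
noncomputable def sigmaInt (s : ℤ) (m : ℕ) : ℂ :=
  ∑ d ∈ m.divisors, (d : ℂ) ^ s

/-- The term of index `m` of the series `V_k(z)`, where `y = Im z`:
`σ_{k-1}(m) e^{-2πi m z̄} ∑_{u=0}^{-k} (4π m y)^u / u!`.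
The inner sum runs over the natural numbers `u ≤ -k`, so it is empty when `k > 0`. -/
noncomputable def VTerm (k : ℤ) (z : ℂ) (m : ℕ) : ℂ :=
  sigmaInt (k - 1) m *
    Complex.exp (-2 * (Real.pi : ℂ) * Complex.I * (m : ℂ) * conj z) *
    ∑ u ∈ Finset.range (1 - k).toNat,
      (4 * (Real.pi : ℂ) * (m : ℂ) * (z.im : ℂ)) ^ u / (u.factorial : ℂ)

/-- `V_k(z) = ∑_{m ≥ 1} σ_{k-1}(m) e^{-2πi m z̄} ∑_{u=0}^{-k} (4π m y)^u / u!`,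
for `z` in the upper half-plane. -/
noncomputable def V (k : ℤ) (z : ℂ) : ℂ :=
  ∑' m : ℕ, VTerm k z (m + 1)

/-- The finite set of pairs `(u, v)` of natural numbers with `u + v = n`, for an integer `n`;
it is empty when `n < 0`. -/
def pairsWithSum (n : ℤ) : Finset (ℕ × ℕ) :=
  if 0 ≤ n then Finset.HasAntidiagonal.antidiagonal n.toNat else ∅

theorem mem_pairsWithSum (n : ℤ) (p : ℕ × ℕ) :
    p ∈ pairsWithSum n ↔ (p.1 : ℤ) + (p.2 : ℤ) = n := by
  unfold pairsWithSum
  split_ifs with h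
  · rw [Finset.HasAntidiagonal.mem_antidiagonal]
    omega
  · simp only [Finset.notMem_empty, false_iff]
    omega

/-- `∑_{u, v ≥ 0, u + v = 1 - k/2} (B_{2u} / (2u)!) (B_{2v} / (2v)!) z ^ (1 - 2v)`,
for an even integer `k`. -/
noncomputable def bernoulliSum (k : ℤ) (z : ℂ) : ℂ :=
  ∑ p ∈ pairsWithSum (1 - k / 2),
    ((bernoulli (2 * p.1) : ℚ) : ℂ) / ((2 * p.1).factorial : ℂ) *
      (((bernoulli (2 * p.2) : ℚ) : ℂ) / ((2 * p.2).factorial : ℂ)) *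
      z ^ (1 - 2 * (p.2 : ℤ))

open Complex Finset Filter Topology Asymptotics

/-! For `k = -w ≤ 0` the inner sum of `VTerm` is a truncated exponential, so `V` at `z` is the
degree-`w` Taylor polynomial of the holomorphic series `divisorSeries w` at `-conj z`, evaluated at
`-z` (`V_neg_natCast`). The inversion `f ↦ s ^ w * f (-1 / s)` preserves polynomials of degree at
most `w`, hence carries Taylor polynomials to Taylor polynomials (`IsJet.inversion`). By uniqueness
of jets, a transformation law for the holomorphic series gives one for `V`. That law is Ramanujan's
formula (`divisorSeries_sub_inversion`) for `w ≥ 2`, and the eta transformation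
(`divisorSeries_zero_sub_inversion`) for `w = 0`. For `w ≥ 2` the terms of the formula of degree at
most `w` are their own jets; only `s⁻¹` and `s ^ (w + 1)` leave remainders, and these produce the
non-holomorphic term in `|z| ^ (2k - 2) - z ^ k`. For `k > 0` the series vanishes and the right side
is checked directly. -/

/-! ### Convergence of the divisor series. -/

theorem norm_sigmaInt_le (s : ℤ) (hs : s ≤ 0) (m : ℕ) : ‖sigmaInt s m‖ ≤ m := by
  unfold sigmaInt
  refine (norm_sum_le _ _).trans ?_
  calc ∑ d ∈ m.divisors, ‖(d : ℂ) ^ s‖ ≤ ∑ d ∈ m.divisors, (1 : ℝ) := by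
        refine Finset.sum_le_sum fun d hd ↦ ?_
        rw [norm_zpow, Complex.norm_natCast]
        exact zpow_le_one_of_nonpos₀ (mod_cast Nat.pos_of_mem_divisors hd) hs
    _ ≤ m := by simpa using Nat.card_divisors_le_self m

theorem norm_exp_two_pi_I_mul_natCast (m : ℕ) (τ : ℂ) :
    ‖exp (2 * Real.pi * I * m * τ)‖ = Real.exp (-2 * Real.pi * τ.im) ^ m := by
  rw [Complex.norm_exp, ← Real.exp_nat_mul]
  congr 1
  simp [Complex.mul_re, Complex.mul_im]
  ring

theorem summable_natCast_pow_mul_exp_pow (j : ℕ) {y : ℝ} (hy : 0 < y) :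
    Summable fun m : ℕ ↦ (m : ℝ) ^ j * Real.exp (-2 * Real.pi * y) ^ m := by
  refine summable_pow_mul_geometric_of_norm_lt_one j ?_
  rw [Real.norm_eq_abs, Real.abs_exp, Real.exp_lt_one_iff]
  have := mul_pos Real.pi_pos hy
  linarith

theorem summable_sigmaInt_mul_pow_mul_exp {s : ℤ} (hs : s ≤ 0) (j : ℕ) {τ : ℂ} (hτ : 0 < τ.im) :
    Summable fun m : ℕ ↦ sigmaInt s m * exp (2 * Real.pi * I * m * τ) * (m : ℂ) ^ j := by
  refine Summable.of_norm_bounded (summable_natCast_pow_mul_exp_pow (j + 1) hτ) fun m ↦ ?_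
  rw [norm_mul, norm_mul, norm_exp_two_pi_I_mul_natCast, norm_pow, Complex.norm_natCast, pow_succ]
  have h := norm_sigmaInt_le s hs m
  calc _ ≤ (m : ℝ) * Real.exp (-2 * Real.pi * τ.im) ^ m * (m : ℝ) ^ j := by gcongr
    _ = _ := by ring

/-- The holomorphic series `∑_{m ≥ 1} σ_{-w-1}(m) e^{2πi m τ}`. -/
noncomputable def divisorSeries (w : ℕ) (τ : ℂ) : ℂ :=
  ∑' m : ℕ+, sigmaInt (-w - 1) m * exp (2 * Real.pi * I * (m : ℕ) * τ)

theorem summable_divisorSeries_coeff (w j : ℕ) {τ : ℂ} (hτ : 0 < τ.im) :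
    Summable fun m : ℕ+ ↦
      sigmaInt (-w - 1) m * exp (2 * Real.pi * I * (m : ℕ) * τ) * ((m : ℕ) : ℂ) ^ j :=
  (summable_sigmaInt_mul_pow_mul_exp (by lia) j hτ).comp_injective PNat.coe_injective

theorem summable_divisorSeries (w : ℕ) {τ : ℂ} (hτ : 0 < τ.im) :
    Summable fun m : ℕ+ ↦ sigmaInt (-w - 1) m * exp (2 * Real.pi * I * (m : ℕ) * τ) := by
  simpa using summable_divisorSeries_coeff w 0 hτ

theorem summable_divisorSeries_taylor (w : ℕ) {a : ℂ} (ha : 0 < a.im) (u : ℕ) (c : ℂ) :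
    Summable fun m : ℕ+ ↦ sigmaInt (-w - 1) m * exp (2 * Real.pi * I * (m : ℕ) * a) *
      ((2 * Real.pi * I * (m : ℕ) * c) ^ u / (u.factorial : ℂ)) := by
  refine ((summable_divisorSeries_coeff w u ha).mul_right
    ((2 * Real.pi * I * c) ^ u / (u.factorial : ℂ))).congr fun m ↦ ?_
  rw [show 2 * Real.pi * I * (m : ℕ) * c = (2 * Real.pi * I * c) * (m : ℕ) by ring,
    mul_pow _ ((m : ℕ) : ℂ)]
  ring

/-! ### Taylor polynomials (jets) and their behaviour under inversion. -/

/-- The Taylor polynomial of degree `w` of `divisorSeries w` at `a`. -/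
noncomputable def divisorSeriesJet (w : ℕ) (a : ℂ) : Polynomial ℂ :=
  ∑ u ∈ range (w + 1), Polynomial.C (∑' m : ℕ+, sigmaInt (-w - 1) m *
    exp (2 * Real.pi * I * (m : ℕ) * a) * ((2 * Real.pi * I * (m : ℕ)) ^ u / (u.factorial : ℂ))) *
    (Polynomial.X - Polynomial.C a) ^ u

theorem eval_divisorSeriesJet (w : ℕ) {a : ℂ} (ha : 0 < a.im) (τ : ℂ) :
    (divisorSeriesJet w a).eval τ = ∑' m : ℕ+, sigmaInt (-w - 1) m *
      exp (2 * Real.pi * I * (m : ℕ) * a) *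
      ∑ u ∈ range (w + 1), (2 * Real.pi * I * (m : ℕ) * (τ - a)) ^ u / (u.factorial : ℂ) := by
  simp_rw [Finset.mul_sum]
  rw [Summable.tsum_finsetSum fun u _ ↦ summable_divisorSeries_taylor w ha u _]
  simp only [divisorSeriesJet, Polynomial.eval_finsetSum, Polynomial.eval_mul,
    Polynomial.eval_C, Polynomial.eval_pow, Polynomial.eval_sub, Polynomial.eval_X]
  refine Finset.sum_congr rfl fun u _ ↦ ?_
  rw [← tsum_mul_right]
  refine tsum_congr fun m ↦ ?_
  rw [mul_pow _ (τ - a)]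
  ring

/-- `p` is a polynomial of degree at most `w` agreeing with `f` at `a` up to order `w`. -/
structure IsJet (w : ℕ) (f : ℂ → ℂ) (a : ℂ) (p : Polynomial ℂ) : Prop where
  natDegree_le : p.natDegree ≤ w
  isBigO : (fun s ↦ f s - p.eval s) =O[𝓝 a] fun s ↦ (s - a) ^ (w + 1)

theorem natDegree_sum_X_sub_C_pow_le (w : ℕ) (a : ℂ) (c : ℕ → ℂ) :
    (∑ u ∈ range (w + 1), Polynomial.C (c u) *
      (Polynomial.X - Polynomial.C a) ^ u).natDegree ≤ w := by
  refine Polynomial.natDegree_sum_le_of_forall_le _ _ fun u hu ↦ ?_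
  refine (Polynomial.natDegree_C_mul_le _ _).trans ?_
  rw [Polynomial.natDegree_pow, Polynomial.natDegree_X_sub_C, mul_one]
  exact Nat.lt_succ_iff.mp (Finset.mem_range.mp hu)

theorem isJet_divisorSeries (w : ℕ) {a : ℂ} (ha : 0 < a.im) :
    IsJet w (divisorSeries w) a (divisorSeriesJet w a) := by
  refine ⟨natDegree_sum_X_sub_C_pow_le _ _ _, ?_⟩
  -- The exponent `w + 2` is one from the bound `σ ≤ m` and `w + 1` from the exponential remainder.
  -- On the ball of radius `Im a / 2` the factor `exp (2πm|τ - a|)` costs at most half of the decay.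
  have hsum := ((summable_natCast_pow_mul_exp_pow (w + 2) (half_pos ha)).mul_left
    ((2 * Real.pi) ^ (w + 1))).comp_injective PNat.coe_injective
  refine IsBigO.of_bound (∑' m : ℕ+, (2 * Real.pi) ^ (w + 1) *
    (((m : ℕ) : ℝ) ^ (w + 2) * Real.exp (-2 * Real.pi * (a.im / 2)) ^ (m : ℕ))) ?_
  filter_upwards [Metric.ball_mem_nhds a (half_pos ha)] with τ hτ
  rw [Metric.mem_ball, dist_eq_norm] at hτ
  have him : 0 < τ.im := by
    have := (Complex.abs_im_le_norm (τ - a)).trans_lt hτ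
    rw [Complex.sub_im, abs_lt] at this
    linarith [this.1]
  have hs : Summable fun m : ℕ+ ↦ sigmaInt (-w - 1) m * exp (2 * Real.pi * I * (m : ℕ) * a) *
      ∑ u ∈ range (w + 1), (2 * Real.pi * I * (m : ℕ) * (τ - a)) ^ u / (u.factorial : ℂ) := by
    simp_rw [Finset.mul_sum]
    exact summable_sum fun u _ ↦ summable_divisorSeries_taylor w ha u _
  rw [eval_divisorSeriesJet w ha, divisorSeries, ← (summable_divisorSeries w him).tsum_sub hs,
    ← tsum_mul_right]
  refine tsum_of_norm_bounded (hsum.mul_right _).hasSum fun m ↦ ?_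
  have hm : exp (2 * Real.pi * I * (m : ℕ) * τ) = exp (2 * Real.pi * I * (m : ℕ) * a) *
      exp (2 * Real.pi * I * (m : ℕ) * (τ - a)) := by rw [← Complex.exp_add]; ring_nf
  have hn : ‖2 * Real.pi * I * (m : ℕ) * (τ - a)‖ = 2 * Real.pi * (m : ℕ) * ‖τ - a‖ := by
    simp [abs_of_pos Real.pi_pos]
  rw [hm, ← mul_assoc, ← mul_sub, norm_mul, norm_mul, norm_exp_two_pi_I_mul_natCast]
  have h1 := norm_sigmaInt_le (-w - 1) (by lia) m
  have h2 := norm_exp_sub_sum_le_norm_mul_exp (2 * Real.pi * I * (m : ℕ) * (τ - a)) (w + 1)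
  rw [hn] at h2
  have h3 : Real.exp (-2 * Real.pi * a.im) ^ (m : ℕ) * Real.exp (2 * Real.pi * (m : ℕ) * ‖τ - a‖)
      ≤ Real.exp (-2 * Real.pi * (a.im / 2)) ^ (m : ℕ) := by
    rw [← Real.exp_nat_mul, ← Real.exp_nat_mul, ← Real.exp_add, Real.exp_le_exp]
    have h4 : 0 ≤ Real.pi * (m : ℕ) * (a.im / 2 - ‖τ - a‖) :=
      mul_nonneg (mul_nonneg Real.pi_pos.le (Nat.cast_nonneg _)) (sub_nonneg.mpr hτ.le)
    linarith
  calc _ ≤ ((m : ℕ) : ℝ) * Real.exp (-2 * Real.pi * a.im) ^ (m : ℕ) *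
        ((2 * Real.pi * (m : ℕ) * ‖τ - a‖) ^ (w + 1) *
          Real.exp (2 * Real.pi * (m : ℕ) * ‖τ - a‖)) := by gcongr
    _ = ((m : ℕ) : ℝ) * (2 * Real.pi * (m : ℕ) * ‖τ - a‖) ^ (w + 1) *
        (Real.exp (-2 * Real.pi * a.im) ^ (m : ℕ) *
          Real.exp (2 * Real.pi * (m : ℕ) * ‖τ - a‖)) := by ring
    _ ≤ ((m : ℕ) : ℝ) * (2 * Real.pi * (m : ℕ) * ‖τ - a‖) ^ (w + 1) *
        Real.exp (-2 * Real.pi * (a.im / 2)) ^ (m : ℕ) := by gcongr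
    _ = _ := by
      simp only [Function.comp_apply, norm_pow, mul_pow]
      ring

/-- Dividing a nonzero `p` by the exact power of `s - a` leaves a cofactor that is nonzero at `a`,
yet the bound forces it to tend to `0` there. -/
theorem Polynomial.eq_zero_of_isBigO {w : ℕ} {a : ℂ} {p : Polynomial ℂ} (hp : p.natDegree ≤ w)
    (h : (fun s ↦ p.eval s) =O[𝓝 a] fun s ↦ (s - a) ^ (w + 1)) : p = 0 := by
  by_contra h0
  obtain ⟨q, hq, hqa⟩ := Polynomial.exists_eq_pow_rootMultiplicity_mul_and_not_dvd p h0 a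
  set n := p.rootMultiplicity a
  have hn : n ≤ w := by
    have hq0 : q ≠ 0 := by rintro rfl; simp at hqa
    have := congrArg Polynomial.natDegree hq
    rw [Polynomial.natDegree_mul (pow_ne_zero _ (Polynomial.X_sub_C_ne_zero a)) hq0,
      Polynomial.natDegree_pow, Polynomial.natDegree_X_sub_C] at this
    lia
  have hO : (fun s ↦ q.eval s) =O[𝓝[≠] a] fun s ↦ (s - a) ^ (w + 1 - n) := by
    have h2 := (h.mono (nhdsWithin_le_nhds (s := {a}ᶜ))).mul
      (isBigO_refl (fun s ↦ ((s - a) ^ n)⁻¹) (𝓝[≠] a))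
    refine (h2.congr' ?_ ?_)
    · filter_upwards [self_mem_nhdsWithin] with s hs
      have : s - a ≠ 0 := sub_ne_zero.mpr hs
      rw [hq]
      simp only [Polynomial.eval_mul, Polynomial.eval_pow, Polynomial.eval_sub, Polynomial.eval_X,
        Polynomial.eval_C]
      field_simp
    · filter_upwards [self_mem_nhdsWithin] with s hs
      have : s - a ≠ 0 := sub_ne_zero.mpr hs
      rw [pow_sub₀ _ this (by lia)]
  have ht : Tendsto (fun s : ℂ ↦ (s - a) ^ (w + 1 - n)) (𝓝[≠] a) (𝓝 0) := by
    have : Continuous fun s : ℂ ↦ (s - a) ^ (w + 1 - n) := by fun_prop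
    have h3 := this.tendsto a
    rw [sub_self, zero_pow (by lia)] at h3
    exact h3.mono_left nhdsWithin_le_nhds
  have h4 := tendsto_nhds_unique (hO.trans_tendsto ht)
    ((q.continuous.tendsto a).mono_left nhdsWithin_le_nhds)
  exact hqa (Polynomial.dvd_iff_isRoot.mpr h4.symm)

namespace IsJet

variable {w : ℕ} {f g : ℂ → ℂ} {a : ℂ} {p q : Polynomial ℂ}

theorem unique (hp : IsJet w f a p) (hq : IsJet w f a q) : p = q := by
  refine sub_eq_zero.mp (Polynomial.eq_zero_of_isBigO (w := w) (a := a) ?_ ?_)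
  · exact (Polynomial.natDegree_sub_le_of_le hp.natDegree_le hq.natDegree_le).trans_eq (max_self w)
  · refine (hq.isBigO.sub hp.isBigO).congr_left fun s ↦ ?_
    rw [Polynomial.eval_sub]
    ring

theorem congr (hp : IsJet w f a p) (h : f =ᶠ[𝓝 a] g) : IsJet w g a p :=
  ⟨hp.natDegree_le, hp.isBigO.congr' (h.mono fun s hs ↦ by simp only [hs]) EventuallyEq.rfl⟩

theorem add (hp : IsJet w f a p) (hq : IsJet w g a q) : IsJet w (fun s ↦ f s + g s) a (p + q) :=
  ⟨(Polynomial.natDegree_add_le_of_le hp.natDegree_le hq.natDegree_le).trans_eq (max_self w),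
    (hp.isBigO.add hq.isBigO).congr_left fun s ↦ by rw [Polynomial.eval_add]; ring⟩

theorem const_mul (c : ℂ) (hp : IsJet w f a p) :
    IsJet w (fun s ↦ c * f s) a (Polynomial.C c * p) :=
  ⟨(Polynomial.natDegree_C_mul_le _ _).trans hp.natDegree_le,
    (hp.isBigO.const_mul_left c).congr_left fun s ↦ by
      rw [Polynomial.eval_mul, Polynomial.eval_C]; ring⟩

theorem of_eval (hp : p.natDegree ≤ w) : IsJet w (fun s ↦ p.eval s) a p :=
  ⟨hp, by simpa using isBigO_zero _ _⟩

theorem sum {ι : Type*} (t : Finset ι) {F : ι → ℂ → ℂ} {P : ι → Polynomial ℂ}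
    (h : ∀ i ∈ t, IsJet w (F i) a (P i)) : IsJet w (fun s ↦ ∑ i ∈ t, F i s) a (∑ i ∈ t, P i) := by
  refine ⟨Polynomial.natDegree_sum_le_of_forall_le _ _ fun i hi ↦ (h i hi).natDegree_le,
    (IsBigO.sum fun i hi ↦ (h i hi).isBigO).congr_left fun s ↦ ?_⟩
  rw [Polynomial.eval_finsetSum, Finset.sum_apply, Finset.sum_sub_distrib]

/-- The Taylor polynomial of degree `w` of `s ↦ s⁻¹` at `a`. -/
noncomputable def _root_.invJet (w : ℕ) (a : ℂ) : Polynomial ℂ :=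
  ∑ u ∈ range (w + 1), Polynomial.C ((-1) ^ u * a⁻¹ ^ (u + 1)) *
    (Polynomial.X - Polynomial.C a) ^ u

/-- The jet is a geometric sum in `1 - s / a`. The exact remainder is needed later, at a point far
from `a`: it yields the `|z| ^ (2k - 2)` term. -/
theorem _root_.eval_invJet (w : ℕ) (ha : a ≠ 0) {s : ℂ} (hs : s ≠ 0) :
    (invJet w a).eval s = s⁻¹ - s⁻¹ * (1 - s / a) ^ (w + 1) := by
  have h1 : (invJet w a).eval s = a⁻¹ * ∑ u ∈ range (w + 1), (1 - s / a) ^ u := by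
    simp only [invJet, Polynomial.eval_finsetSum, Polynomial.eval_mul, Polynomial.eval_C,
      Polynomial.eval_pow, Polynomial.eval_sub, Polynomial.eval_X, Finset.mul_sum]
    refine Finset.sum_congr rfl fun u _ ↦ ?_
    rw [show 1 - s / a = -1 * a⁻¹ * (s - a) by field_simp; ring, mul_pow, mul_pow]
    ring
  have h2 := geom_sum_mul (1 - s / a) (w + 1)
  rw [h1, ← mul_right_inj' hs]
  have h3 : s * (a⁻¹ * ∑ u ∈ range (w + 1), (1 - s / a) ^ u) =
      -((∑ u ∈ range (w + 1), (1 - s / a) ^ u) * (1 - s / a - 1)) := by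
    field_simp
    ring
  rw [h3, h2]
  field_simp
  ring

theorem inv (w : ℕ) (ha : a ≠ 0) : IsJet w (fun s ↦ s⁻¹) a (invJet w a) := by
  refine ⟨natDegree_sum_X_sub_C_pow_le _ _ _, ?_⟩
  have hc : ContinuousAt (fun s : ℂ ↦ s⁻¹ * (-a⁻¹) ^ (w + 1)) a :=
    (continuousAt_inv₀ ha).mul continuousAt_const
  refine ((hc.isBigO_one ℂ).mul (isBigO_refl (fun s ↦ (s - a) ^ (w + 1)) _)).congr' ?_ ?_
  · filter_upwards [isOpen_ne.mem_nhds ha] with s hs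
    rw [eval_invJet w ha hs, sub_sub_cancel, show 1 - s / a = -a⁻¹ * (s - a) by field_simp; ring,
      mul_pow]
    ring
  · simp

/-- The leading terms of two monic polynomials cancel; the remainder is exactly `(s - a) ^ (w + 1)`.
-/
theorem pow_succ (w : ℕ) (a : ℂ) : IsJet w (fun s ↦ s ^ (w + 1)) a
    (Polynomial.X ^ (w + 1) - (Polynomial.X - Polynomial.C a) ^ (w + 1)) := by
  have hd : ((Polynomial.X - Polynomial.C a) ^ (w + 1)).natDegree = w + 1 := by
    rw [Polynomial.natDegree_pow, Polynomial.natDegree_X_sub_C, mul_one]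
  refine ⟨?_, (isBigO_refl _ _).congr_left fun s ↦ by simp⟩
  have hm : (Polynomial.X ^ (w + 1) : Polynomial ℂ).Monic := Polynomial.monic_X_pow _
  have := Polynomial.degree_sub_lt_left (p := (Polynomial.X : Polynomial ℂ) ^ (w + 1))
    (q := (Polynomial.X - Polynomial.C a) ^ (w + 1)) (by
      rw [Polynomial.degree_eq_natDegree hm.ne_zero, Polynomial.degree_eq_natDegree
        ((Polynomial.monic_X_sub_C a).pow _).ne_zero, hd, Polynomial.natDegree_X_pow])
    hm.ne_zero (by rw [hm, ((Polynomial.monic_X_sub_C a).pow _)])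
  rw [Polynomial.degree_X_pow] at this
  exact Polynomial.natDegree_le_iff_degree_le.mpr (Order.lt_succ_iff.mp (by exact_mod_cast this))

/-- The weight `-w` inversion maps jets at `-1 / a` to jets at `a`. -/
theorem inversion (ha : a ≠ 0) (hp : IsJet w f (-1 / a) p) :
    ∃ q : Polynomial ℂ, IsJet w (fun s ↦ s ^ w * f (-1 / s)) a q ∧
      ∀ s, s ≠ 0 → q.eval s = s ^ w * p.eval (-1 / s) := by
  -- `s ^ w * (-1 / s) ^ j = (-1) ^ j * s ^ (w - j)`, a polynomial because `j ≤ w`.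
  let q : Polynomial ℂ := ∑ j ∈ range (w + 1),
    Polynomial.C (p.coeff j * (-1) ^ j) * Polynomial.X ^ (w - j)
  have hq : ∀ s, s ≠ 0 → q.eval s = s ^ w * p.eval (-1 / s) := fun s hs ↦ by
    rw [Polynomial.eval_eq_sum_range' (Nat.lt_succ_of_le hp.natDegree_le)]
    simp only [q, Polynomial.eval_finsetSum, Polynomial.eval_mul, Polynomial.eval_C,
      Polynomial.eval_pow, Polynomial.eval_X, Finset.mul_sum]
    refine Finset.sum_congr rfl fun j hj ↦ ?_
    rw [pow_sub₀ _ hs (Nat.lt_succ_iff.mp (Finset.mem_range.mp hj)), div_pow]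
    field_simp
  refine ⟨q, ⟨Polynomial.natDegree_sum_le_of_forall_le _ _ fun j _ ↦
    (Polynomial.natDegree_C_mul_X_pow_le _ _).trans (Nat.sub_le _ _), ?_⟩, hq⟩
  have hct : ContinuousAt (fun s : ℂ ↦ -1 / s) a := continuousAt_const.div continuousAt_id ha
  have h1 := hp.isBigO.comp_tendsto hct
  have hc : ContinuousAt (fun s : ℂ ↦ s ^ w * (s⁻¹ * a⁻¹) ^ (w + 1)) a :=
    (continuousAt_id.pow w).mul (((continuousAt_inv₀ ha).mul continuousAt_const).pow _)
  have h2 := (isBigO_refl (fun s : ℂ ↦ s ^ w) (𝓝 a)).mul h1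
  refine (h2.congr' ?_ ?_).trans
    (((hc.isBigO_one ℂ).mul (isBigO_refl (fun s ↦ (s - a) ^ (w + 1)) _)).congr_right fun s ↦
      one_mul _)
  · filter_upwards [isOpen_ne.mem_nhds ha] with s hs
    simp only [Function.comp_apply]
    rw [hq s hs]
    ring
  · filter_upwards [isOpen_ne.mem_nhds ha] with s hs
    simp only [Function.comp_apply]
    rw [mul_assoc, ← mul_pow, show -1 / s - -1 / a = s⁻¹ * a⁻¹ * (s - a) by
      have : s ≠ 0 := hs
      field_simp
      ring]

end IsJet

/-! ### `V` as a value of a Taylor polynomial. -/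

/-- Since `-z + conj z = -2iy`, one has `2πim(-z + conj z) = 4πmy`. -/
theorem VTerm_neg_natCast (w : ℕ) (z : ℂ) (m : ℕ) :
    VTerm (-w) z m = sigmaInt (-w - 1) m * exp (2 * Real.pi * I * m * (-conj z)) *
      ∑ u ∈ range (w + 1), (2 * Real.pi * I * m * (-z - -conj z)) ^ u / (u.factorial : ℂ) := by
  have h : -z - -conj z = -2 * I * (z.im : ℂ) := by
    have := Complex.sub_conj z
    push_cast at this
    linear_combination -this
  unfold VTerm
  rw [show (1 - -(w : ℤ)).toNat = w + 1 by lia, h]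
  rw [show -2 * (Real.pi : ℂ) * I * m * conj z = 2 * Real.pi * I * m * (-conj z) by ring,
    show 2 * Real.pi * I * m * (-2 * I * (z.im : ℂ)) = 4 * Real.pi * m * z.im by
      linear_combination -4 * Real.pi * m * z.im * I_sq]

theorem neg_conj_im (z : ℂ) : (-conj z).im = z.im := by simp

theorem summable_VTerm_neg_natCast (w : ℕ) {z : ℂ} (hz : 0 < z.im) :
    Summable fun m : ℕ ↦ VTerm (-w) z (m + 1) := by
  refine (summable_pnat_iff_summable_succ (f := VTerm (-w) z)).mp ?_
  simp_rw [VTerm_neg_natCast, Finset.mul_sum]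
  exact summable_sum fun u _ ↦ summable_divisorSeries_taylor w (by rwa [neg_conj_im]) u _

theorem V_neg_natCast (w : ℕ) {z : ℂ} (hz : 0 < z.im) :
    V (-w) z = (divisorSeriesJet w (-conj z)).eval (-z) := by
  rw [eval_divisorSeriesJet w (by rwa [neg_conj_im]), V,
    ← tsum_pnat_eq_tsum_succ (f := fun m ↦ VTerm (-w) z m)]
  simp_rw [VTerm_neg_natCast]

/-! ### Ramanujan's formula through the partial fractions of the cotangent. -/

/-- Equates the `q`-expansion and the partial fraction expansion of `π cot πτ`. -/
theorem tsum_pnat_pow_eq_cot {τ : ℂ} (hτ : 0 < τ.im) :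
    ∑' r : ℕ+, exp (2 * Real.pi * I * τ) ^ (r : ℕ) =
      -1 / 2 + I / (2 * Real.pi) * (1 / τ + ∑' n : ℕ+, 2 * τ / (τ ^ 2 - (n : ℂ) ^ 2)) := by
  have hq : ‖exp (2 * Real.pi * I * τ)‖ < 1 := UpperHalfPlane.norm_exp_two_pi_I_lt_one ⟨τ, hτ⟩
  have h1 := pi_mul_cot_pi_q_exp ⟨τ, hτ⟩
  have h2 := cot_series_rep (UpperHalfPlane.coe_mem_integerComplement ⟨τ, hτ⟩)
  rw [h1] at h2
  rw [UpperHalfPlane.coe_mk] at h2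
  have h3 := tsum_zero_pnat_eq_tsum_nat (f := fun n ↦ exp (2 * Real.pi * I * τ) ^ n)
    (summable_geometric_of_norm_lt_one hq)
  have h4 : ∀ n : ℕ+, 1 / (τ - n) + 1 / (τ + n) = 2 * τ / (τ ^ 2 - (n : ℂ) ^ 2) := fun n ↦ by
    have h5 : τ - n ≠ 0 := fun h ↦ by
      have := congrArg Complex.im h; simp at this; exact hτ.ne' this
    have h6 : τ + n ≠ 0 := fun h ↦ by
      have := congrArg Complex.im h; simp at this; exact hτ.ne' this
    rw [sq_sub_sq]
    field_simp
    ring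
  simp_rw [h4] at h2
  rw [← h2, ← h3, pow_zero]
  have hpi : (Real.pi : ℂ) ≠ 0 := mod_cast Real.pi_ne_zero
  generalize ∑' r : ℕ+, exp (2 * Real.pi * I * τ) ^ (r : ℕ) = S
  field_simp
  linear_combination (1 + 2 * S) * I_sq

theorem summable_natCast_one_div_pow {k : ℕ} (hk : 1 < k) :
    Summable fun n : ℕ ↦ 1 / (n : ℂ) ^ k :=
  Summable.of_norm (by simpa using Real.summable_nat_pow_inv.mpr hk)

theorem riemannZeta_eq_tsum_pnat {k : ℕ} (hk : 1 < k) :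
    riemannZeta k = ∑' n : ℕ+, 1 / ((n : ℕ) : ℂ) ^ k := by
  rw [zeta_nat_eq_tsum_of_gt_one hk, tsum_pnat_eq_tsum_succ (f := fun n : ℕ ↦ 1 / (n : ℂ) ^ k),
    Summable.tsum_eq_zero_add (summable_natCast_one_div_pow hk)]
  simp [show k ≠ 0 by lia]

theorem summable_pnat_one_div_pow {k : ℕ} (hk : 1 < k) :
    Summable fun n : ℕ+ ↦ 1 / ((n : ℕ) : ℂ) ^ k :=
  (summable_natCast_one_div_pow hk).comp_injective PNat.coe_injective

/-- Writes `m = d * r`; the double series converges absolutely and may be summed over `r` first. -/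
theorem divisorSeries_eq_tsum_prod (w : ℕ) {τ : ℂ} (hτ : 0 < τ.im) :
    divisorSeries w τ = ∑' d : ℕ+, 1 / ((d : ℕ) : ℂ) ^ (w + 1) *
      ∑' r : ℕ+, exp (2 * Real.pi * I * ((d : ℕ) * τ)) ^ (r : ℕ) := by
  have hq : ‖exp (2 * Real.pi * I * τ)‖ < 1 := UpperHalfPlane.norm_exp_two_pi_I_lt_one ⟨τ, hτ⟩
  have hS : Summable fun c : ℕ+ × ℕ+ ↦ 1 / ((c.1 : ℕ) : ℂ) ^ (w + 1) *
      exp (2 * Real.pi * I * τ) ^ ((c.1 : ℕ) * c.2) := by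
    refine Summable.of_norm_bounded (summable_prod_mul_pow 0 hq).norm fun c ↦ ?_
    rw [pow_zero, one_mul, norm_mul]
    refine mul_le_of_le_one_left (norm_nonneg _) ?_
    rw [norm_div, norm_one, norm_pow, Complex.norm_natCast]
    exact div_le_one_of_le₀ (one_le_pow₀ (mod_cast c.1.2)) (by positivity)
  have hS' := (sigmaAntidiagonalEquivProd.summable_iff).mpr hS
  calc divisorSeries w τ = ∑' c : ℕ+ × ℕ+, 1 / ((c.1 : ℕ) : ℂ) ^ (w + 1) *
      exp (2 * Real.pi * I * τ) ^ ((c.1 : ℕ) * c.2) := by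
        rw [← sigmaAntidiagonalEquivProd.tsum_eq]
        refine Eq.trans ?_ hS'.tsum_sigma.symm
        rw [divisorSeries]
        refine tsum_congr fun n ↦ ?_
        rw [tsum_fintype, sigmaInt, Finset.sum_mul,
          ← Nat.sum_divisorsAntidiagonal (fun d _ ↦ (d : ℂ) ^ (-w - 1 : ℤ) *
            exp (2 * Real.pi * I * (n : ℕ) * τ)), Finset.univ_eq_attach,
          ← Finset.sum_attach]
        refine Finset.sum_congr rfl fun x _ ↦ ?_
        have hx := (Nat.mem_divisorsAntidiagonal.mp x.2).1
        change _ = 1 / ((x.1.1 : ℕ) : ℂ) ^ (w + 1) * exp (2 * Real.pi * I * τ) ^ (x.1.1 * x.1.2)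
        rw [hx, ← Complex.exp_nat_mul]
        rw [show (-w - 1 : ℤ) = -((w + 1 : ℕ) : ℤ) by push_cast; ring, zpow_neg, zpow_natCast,
          one_div]
        congr 2
        ring
    _ = _ := by
        rw [hS.tsum_prod]
        refine tsum_congr fun d ↦ ?_
        rw [← tsum_mul_left]
        refine tsum_congr fun r ↦ ?_
        rw [← Complex.exp_nat_mul, ← Complex.exp_nat_mul]
        congr 2
        push_cast
        ring

/-- Multiplying by `conj τ` makes the `d` term real, so the bound is uniform in `d`. The factor `d ^
w` then remains free for convergence over `d` in `summable_cotDoubleTerm`. -/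
theorem le_norm_mul_sub {τ : ℂ} (n d : ℝ) : ‖τ‖ * ‖d * τ - n‖ ≥ |n * τ.im| := by
  have h := Complex.abs_im_le_norm (conj τ * (d * τ - n))
  rw [norm_mul, Complex.norm_conj] at h
  refine le_trans (le_of_eq ?_) h
  congr 1
  simp [Complex.mul_im]
  ring

theorem norm_sq_sub_sq_ge {τ : ℂ} (hτ : 0 < τ.im) (d n : ℝ) :
    (τ.im / ‖τ‖) ^ 2 * n ^ 2 ≤ ‖d ^ 2 * τ ^ 2 - n ^ 2‖ := by
  have h0 : 0 < ‖τ‖ := hτ.trans_le ((le_abs_self _).trans (Complex.abs_im_le_norm τ))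
  have h1 := le_norm_mul_sub (τ := τ) n d
  have h2 := le_norm_mul_sub (τ := τ) (-n) d
  rw [show (d : ℂ) ^ 2 * τ ^ 2 - n ^ 2 = (d * τ - n) * (d * τ - (-n : ℝ)) by push_cast; ring,
    norm_mul, div_pow, div_mul_eq_mul_div, div_le_iff₀ (by positivity)]
  rw [neg_mul, abs_neg] at h2
  calc τ.im ^ 2 * n ^ 2 = |n * τ.im| * |n * τ.im| := by rw [abs_mul_abs_self]; ring
    _ ≤ (‖τ‖ * ‖d * τ - n‖) * (‖τ‖ * ‖d * τ - (-n : ℝ)‖) := by gcongr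
    _ = _ := by ring

theorem sq_mul_sq_sub_sq_ne_zero {τ : ℂ} (hτ : 0 < τ.im) (d n : ℕ+) :
    ((d : ℕ) : ℂ) ^ 2 * τ ^ 2 - ((n : ℕ) : ℂ) ^ 2 ≠ 0 := by
  have h0 : 0 < ‖τ‖ := hτ.trans_le ((le_abs_self _).trans (Complex.abs_im_le_norm τ))
  have h := norm_sq_sub_sq_ge hτ (d : ℕ) (n : ℕ)
  rw [← norm_pos_iff]
  push_cast at h
  have hn : (0 : ℝ) < (n : ℕ) := mod_cast n.2
  exact lt_of_lt_of_le (by positivity) h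

/-- The double series obtained from the partial fractions of the cotangent. -/
noncomputable def cotDoubleTerm (w : ℕ) (τ : ℂ) (c : ℕ+ × ℕ+) : ℂ :=
  1 / (((c.1 : ℕ) : ℂ) ^ w * (((c.1 : ℕ) : ℂ) ^ 2 * τ ^ 2 - ((c.2 : ℕ) : ℂ) ^ 2))

theorem summable_cotDoubleTerm {w : ℕ} (hw : 1 < w) {τ : ℂ} (hτ : 0 < τ.im) :
    Summable (cotDoubleTerm w τ) := by
  have h0 : 0 < ‖τ‖ := hτ.trans_le ((le_abs_self _).trans (Complex.abs_im_le_norm τ))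
  have h1 : Summable fun c : ℕ+ × ℕ+ ↦
      ‖1 / ((c.1 : ℕ) : ℂ) ^ w‖ * ‖1 / ((c.2 : ℕ) : ℂ) ^ 2‖ :=
    (summable_pnat_one_div_pow hw).norm.mul_of_nonneg (summable_pnat_one_div_pow one_lt_two).norm
      (fun _ ↦ norm_nonneg _) (fun _ ↦ norm_nonneg _)
  refine Summable.of_norm_bounded (h1.mul_left ((τ.im / ‖τ‖) ^ 2)⁻¹) fun c ↦ ?_
  have h := norm_sq_sub_sq_ge hτ (c.1 : ℕ) (c.2 : ℕ)
  push_cast at h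
  have hc1 : (0 : ℝ) < (c.1 : ℕ) := mod_cast c.1.2
  have hc2 : (0 : ℝ) < (c.2 : ℕ) := mod_cast c.2.2
  rw [cotDoubleTerm, norm_div, norm_div, norm_div, norm_mul, norm_one, norm_pow, norm_pow,
    Complex.norm_natCast, Complex.norm_natCast]
  calc 1 / (((c.1 : ℕ) : ℝ) ^ w * ‖((c.1 : ℕ) : ℂ) ^ 2 * τ ^ 2 - ((c.2 : ℕ) : ℂ) ^ 2‖)
      ≤ 1 / (((c.1 : ℕ) : ℝ) ^ w * ((τ.im / ‖τ‖) ^ 2 * ((c.2 : ℕ) : ℝ) ^ 2)) := by gcongr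
    _ = _ := by
      field_simp

theorem divisorSeries_eq_tsum_cotDoubleTerm {w : ℕ} (hw : 1 < w) {τ : ℂ} (hτ : 0 < τ.im) :
    divisorSeries w τ = -1 / 2 * riemannZeta (w + 1) + I / (2 * Real.pi) *
      (riemannZeta (w + 2) / τ + 2 * τ * ∑' c, cotDoubleTerm w τ c) := by
  have hS := summable_cotDoubleTerm hw hτ
  have h0 : τ ≠ 0 := by rintro rfl; simp at hτ
  have hz1 := riemannZeta_eq_tsum_pnat (k := w + 1) (by lia)
  have hz2 := riemannZeta_eq_tsum_pnat (k := w + 2) (by lia)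
  push_cast at hz1 hz2
  rw [divisorSeries_eq_tsum_prod w hτ, hS.tsum_prod, hz1, hz2, ← tsum_mul_left, div_eq_mul_inv _ τ,
    ← tsum_mul_right, ← tsum_mul_left, ← Summable.tsum_add, ← tsum_mul_left, ← Summable.tsum_add]
  · refine tsum_congr fun d ↦ ?_
    have hd : ((d : ℕ) : ℂ) ≠ 0 := by simp
    rw [tsum_pnat_pow_eq_cot (τ := (d : ℕ) * τ) (by simpa using hτ), ← tsum_mul_left]
    have : ∑' n : ℕ+, 2 * ((d : ℕ) * τ) / (((d : ℕ) * τ) ^ 2 - (n : ℂ) ^ 2) =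
        ((d : ℕ) : ℂ) ^ (w + 1) * ∑' n : ℕ+, 2 * τ * cotDoubleTerm w τ (d, n) := by
      rw [← tsum_mul_left]
      refine tsum_congr fun n ↦ ?_
      have := sq_mul_sq_sub_sq_ne_zero hτ d n
      rw [cotDoubleTerm, mul_pow]
      field_simp
      ring
    rw [this, tsum_mul_left]
    field_simp
    ring
  · exact (summable_pnat_one_div_pow (by lia)).mul_left _
  · exact ((((summable_pnat_one_div_pow (by lia)).mul_right _).add (hS.prod.mul_left _)).mul_left _)
  · exact (summable_pnat_one_div_pow (by lia)).mul_right _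
  · exact hS.prod.mul_left _

theorem neg_one_div_im_pos {τ : ℂ} (hτ : 0 < τ.im) : 0 < (-1 / τ).im := by
  have h0 : τ ≠ 0 := by rintro rfl; simp at hτ
  rw [neg_div, Complex.neg_im, one_div, Complex.inv_im, neg_div, neg_neg]
  exact div_pos hτ (Complex.normSq_pos.mpr h0)

/-- After swapping `d` and `n` in the second series, both terms have the factor `d²τ² - n²` in the
denominator. It divides the combined numerator `n ^ (2j + 2) - (dτ) ^ (2j + 2)`, and the quotient is
a finite geometric sum whose terms separate into products of zeta values. -/
theorem cotDoubleTerm_add_inversion (j : ℕ) {τ : ℂ} (hτ : 0 < τ.im) :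
    ∑' c, cotDoubleTerm (2 * (j + 1)) τ c + τ ^ (2 * j) *
      ∑' c, cotDoubleTerm (2 * (j + 1)) (-1 / τ) c =
      -∑ a ∈ range (j + 1), τ ^ (2 * a) * (riemannZeta (2 * ((j + 1 - a : ℕ) : ℂ)) *
        riemannZeta (2 * ((a + 1 : ℕ) : ℂ))) := by
  have h0 : τ ≠ 0 := by rintro rfl; simp at hτ
  have hτ' : 0 < (-1 / τ).im := neg_one_div_im_pos hτ
  have hs1 := summable_cotDoubleTerm (w := 2 * (j + 1)) (by lia) hτ
  have hs2 := summable_cotDoubleTerm (w := 2 * (j + 1)) (by lia) hτ'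
  have hswap : τ ^ (2 * j) * ∑' c, cotDoubleTerm (2 * (j + 1)) (-1 / τ) c =
      ∑' c, ((fun c ↦ τ ^ (2 * j) * cotDoubleTerm (2 * (j + 1)) (-1 / τ) c) ∘
        Equiv.prodComm ℕ+ ℕ+) c := by
    rw [← tsum_mul_left]
    exact ((Equiv.prodComm ℕ+ ℕ+).tsum_eq _).symm
  have hz : ∀ k : ℕ, riemannZeta (2 * ((k + 1 : ℕ) : ℂ)) =
      ∑' n : ℕ+, 1 / ((n : ℕ) : ℂ) ^ (2 * (k + 1)) := fun k ↦ by
    rw [← riemannZeta_eq_tsum_pnat (by lia)]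
    push_cast
    rfl
  have hm : ∀ a b : ℕ, Summable fun c : ℕ+ × ℕ+ ↦ 1 / ((c.1 : ℕ) : ℂ) ^ (2 * (a + 1)) *
      (1 / ((c.2 : ℕ) : ℂ) ^ (2 * (b + 1))) := fun a b ↦
    summable_mul_of_summable_norm (f := fun n : ℕ+ ↦ 1 / ((n : ℕ) : ℂ) ^ (2 * (a + 1)))
      (g := fun n : ℕ+ ↦ 1 / ((n : ℕ) : ℂ) ^ (2 * (b + 1))) (summable_pnat_one_div_pow (by lia)).norm
      (summable_pnat_one_div_pow (by lia)).norm
  have hprod : ∀ a ∈ range (j + 1), riemannZeta (2 * ((j + 1 - a : ℕ) : ℂ)) *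
        riemannZeta (2 * ((a + 1 : ℕ) : ℂ)) = ∑' c : ℕ+ × ℕ+,
      1 / ((c.1 : ℕ) : ℂ) ^ (2 * (j - a + 1)) * (1 / ((c.2 : ℕ) : ℂ) ^ (2 * (a + 1))) := by
    intro a ha
    rw [show j + 1 - a = j - a + 1 by have := Finset.mem_range.mp ha; lia, hz, hz]
    exact tsum_mul_tsum_of_summable_norm (summable_pnat_one_div_pow (by lia)).norm
      (summable_pnat_one_div_pow (by lia)).norm
  rw [Finset.sum_congr rfl fun a ha ↦ by rw [hprod a ha, ← tsum_mul_left],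
    ← Summable.tsum_finsetSum fun a _ ↦ (hm _ _).mul_left _, ← tsum_neg, hswap,
    ← Summable.tsum_add hs1 ((Equiv.prodComm ℕ+ ℕ+).summable_iff.mpr (hs2.mul_left _))]
  refine tsum_congr fun ⟨d, n⟩ ↦ ?_
  have hd : ((d : ℕ) : ℂ) ≠ 0 := by simp
  have hn : ((n : ℕ) : ℂ) ≠ 0 := by simp
  have h1 := sq_mul_sq_sub_sq_ne_zero hτ d n
  have h2 : ((n : ℕ) : ℂ) ^ 2 - ((d : ℕ) : ℂ) ^ 2 * τ ^ 2 ≠ 0 := fun h ↦ h1 (by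
    linear_combination -h)
  have hg := geom_sum₂_mul (((d : ℕ) : ℂ) ^ 2 * τ ^ 2) (((n : ℕ) : ℂ) ^ 2) (j + 1)
  have hR : ∑ a ∈ range (j + 1), τ ^ (2 * a) * (1 / ((d : ℕ) : ℂ) ^ (2 * (j - a + 1)) *
      (1 / ((n : ℕ) : ℂ) ^ (2 * (a + 1)))) = (∑ i ∈ range (j + 1),
        (((d : ℕ) : ℂ) ^ 2 * τ ^ 2) ^ i * (((n : ℕ) : ℂ) ^ 2) ^ (j + 1 - 1 - i)) /
        (((d : ℕ) : ℂ) ^ (2 * (j + 1)) * ((n : ℕ) : ℂ) ^ (2 * (j + 1))) := by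
    rw [Finset.sum_div]
    refine Finset.sum_congr rfl fun a ha ↦ ?_
    obtain ⟨b, rfl⟩ := Nat.exists_eq_add_of_le (Nat.lt_succ_iff.mp (Finset.mem_range.mp ha))
    rw [show a + b + 1 - 1 - a = b by lia, show a + b - a = b by lia]
    field_simp
    ring
  rw [hR, eq_div_of_mul_eq h1 hg]
  simp only [cotDoubleTerm, Function.comp_apply, Equiv.prodComm_apply, Prod.swap_prod_mk]
  have h3 : ((n : ℕ) : ℂ) ^ 2 * (-1 / τ) ^ 2 - ((d : ℕ) : ℂ) ^ 2 =
    -(((d : ℕ) : ℂ) ^ 2 * τ ^ 2 - ((n : ℕ) : ℂ) ^ 2) / τ ^ 2 := by field_simp; ring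
  rw [h3]
  field_simp
  ring

/-- Ramanujan's formula for the inversion of `∑ σ_{-w-1}(m) e^{2πi m τ}`, `w = 2j + 2`. -/
theorem divisorSeries_sub_inversion (j : ℕ) {τ : ℂ} (hτ : 0 < τ.im) :
    divisorSeries (2 * (j + 1)) τ - τ ^ (2 * (j + 1)) * divisorSeries (2 * (j + 1)) (-1 / τ) =
      -1 / 2 * riemannZeta (2 * (j + 1) + 1) * (1 - τ ^ (2 * (j + 1))) +
      I / (2 * Real.pi) * (riemannZeta (2 * (j + 1) + 2) * (τ⁻¹ + τ ^ (2 * (j + 1) + 1)) -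
        2 * ∑ a ∈ range (j + 1), τ ^ (2 * a + 1) * (riemannZeta (2 * ((j + 1 - a : ℕ) : ℂ)) *
        riemannZeta (2 * ((a + 1 : ℕ) : ℂ)))) := by
  have h0 : τ ≠ 0 := by rintro rfl; simp at hτ
  have hτ' : 0 < (-1 / τ).im := neg_one_div_im_pos hτ
  have h := cotDoubleTerm_add_inversion j hτ
  have hS : ∑ a ∈ range (j + 1), τ ^ (2 * a + 1) * (riemannZeta (2 * ((j + 1 - a : ℕ) : ℂ)) *
        riemannZeta (2 * ((a + 1 : ℕ) : ℂ))) = τ * ∑ a ∈ range (j + 1), τ ^ (2 * a) *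
      (riemannZeta (2 * ((j + 1 - a : ℕ) : ℂ)) * riemannZeta (2 * ((a + 1 : ℕ) : ℂ))) := by
    rw [Finset.mul_sum]
    exact Finset.sum_congr rfl fun a _ ↦ by ring
  rw [hS, ← neg_eq_iff_eq_neg.mpr h, divisorSeries_eq_tsum_cotDoubleTerm (by lia) hτ,
    divisorSeries_eq_tsum_cotDoubleTerm (by lia) hτ']
  push_cast
  field_simp
  ring

/-! ### Weight zero: the logarithm of the eta function. -/

theorem hasDerivAt_divisorSeries (w : ℕ) {τ : ℂ} (hτ : 0 < τ.im) :
    HasDerivAt (divisorSeries w) (∑' m : ℕ+, sigmaInt (-w - 1) m *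
      (exp (2 * Real.pi * I * (m : ℕ) * τ) * (2 * Real.pi * I * (m : ℕ)))) τ := by
  have hsum := ((summable_natCast_pow_mul_exp_pow 2 (half_pos hτ)).mul_left
    (2 * Real.pi)).comp_injective PNat.coe_injective
  refine hasDerivAt_tsum_of_isPreconnected
    (g := fun (m : ℕ+) s ↦ sigmaInt (-w - 1) m * exp (2 * Real.pi * I * (m : ℕ) * s))
    (g' := fun (m : ℕ+) s ↦ sigmaInt (-w - 1) m *
      (exp (2 * Real.pi * I * (m : ℕ) * s) * (2 * Real.pi * I * (m : ℕ))))
    (u := fun m : ℕ+ ↦ 2 * Real.pi * (((m : ℕ) : ℝ) ^ 2 *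
      Real.exp (-2 * Real.pi * (τ.im / 2)) ^ (m : ℕ))) (t := {s : ℂ | τ.im / 2 < s.im}) hsum
    (isOpen_lt continuous_const Complex.continuous_im)
    (convex_halfSpace_im_gt _).isPreconnected (fun m s _ ↦ ?_) (fun m s hs ↦ ?_)
    (y₀ := τ) (half_lt_self hτ) (summable_divisorSeries w hτ) (half_lt_self hτ)
  · have := ((hasDerivAt_id s).const_mul (2 * Real.pi * I * (m : ℕ))).cexp.const_mul
      (sigmaInt (-w - 1) m)
    simpa using this
  · rw [norm_mul, norm_mul, norm_exp_two_pi_I_mul_natCast]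
    have h1 := norm_sigmaInt_le (-w - 1) (by lia) m
    have h2 : ‖2 * Real.pi * I * ((m : ℕ) : ℂ)‖ = 2 * Real.pi * (m : ℕ) := by
      simp [abs_of_pos Real.pi_pos]
    have h3 : Real.exp (-2 * Real.pi * s.im) ≤ Real.exp (-2 * Real.pi * (τ.im / 2)) := by
      rw [Real.exp_le_exp]
      have := mul_le_mul_of_nonneg_left (le_of_lt hs) Real.pi_pos.le
      linarith
    rw [h2]
    calc _ ≤ ((m : ℕ) : ℝ) * (Real.exp (-2 * Real.pi * (τ.im / 2)) ^ (m : ℕ) *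
          (2 * Real.pi * (m : ℕ))) := by gcongr
      _ = _ := by ring

theorem natCast_mul_sigmaInt_neg_one (m : ℕ) :
    (m : ℂ) * sigmaInt (-1) m = ArithmeticFunction.sigma 1 m := by
  rw [ArithmeticFunction.sigma_one_apply, sigmaInt, Finset.mul_sum,
    ← Nat.sum_div_divisors m (fun d ↦ d)]
  push_cast
  refine Finset.sum_congr rfl fun d hd ↦ ?_
  have hd0 : (d : ℂ) ≠ 0 := mod_cast (Nat.pos_of_mem_divisors hd).ne'
  rw [Nat.cast_div (Nat.dvd_of_mem_divisors hd) hd0, zpow_neg_one, div_eq_mul_inv]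

/-- Differentiation multiplies `σ_{-1}(m)` by `m`, giving `σ_1(m)`, the coefficients of `G2`. -/
theorem hasDerivAt_divisorSeries_zero (τ : UpperHalfPlane) :
    HasDerivAt (divisorSeries 0)
      (I / (4 * Real.pi) * (Real.pi ^ 2 / 3 - EisensteinSeries.G2 τ)) τ := by
  convert hasDerivAt_divisorSeries 0 τ.im_pos using 1
  have h : ∀ m : ℕ+, sigmaInt (-(0 : ℕ) - 1) m *
      (exp (2 * Real.pi * I * (m : ℕ) * τ) * (2 * Real.pi * I * (m : ℕ))) =
      2 * Real.pi * I * (ArithmeticFunction.sigma 1 m *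
        exp (2 * Real.pi * I * τ) ^ (m : ℕ)) := fun m ↦ by
    rw [← natCast_mul_sigmaInt_neg_one, ← Complex.exp_nat_mul]
    simp only [Nat.cast_zero, neg_zero, zero_sub]
    ring_nf
  rw [tsum_congr h, tsum_mul_left, EisensteinSeries.G2_eq_tsum_cexp, riemannZeta_two]
  have hpi : (Real.pi : ℂ) ≠ 0 := mod_cast Real.pi_ne_zero
  field_simp
  ring

/-- The inversion formula of `∑ σ_{-1}(m) e^{2πi m τ}`, that is, of the logarithm of the
Dedekind eta function. -/
theorem divisorSeries_zero_sub_inversion {τ : ℂ} (hτ : 0 < τ.im) :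
    2 * (divisorSeries 0 τ - divisorSeries 0 (-1 / τ)) =
      Real.pi * I / 6 * (τ + τ⁻¹) + log τ - Real.pi * I / 2 := by
  let U : Set ℂ := {s | 0 < s.im}
  have hU : IsOpen U := isOpen_lt continuous_const Complex.continuous_im
  have hU' : IsPreconnected U := (convex_halfSpace_im_gt 0).isPreconnected
  let H : ℂ → ℂ := fun s ↦ 2 * (divisorSeries 0 s - divisorSeries 0 (-1 / s)) -
    (Real.pi * I / 6 * (s + s⁻¹) + log s)
  have hd : ∀ s ∈ U, HasDerivAt H 0 s := fun s hs ↦ by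
    have hs' : 0 < s.im := hs
    have h0 : s ≠ 0 := by rintro rfl; simp at hs'
    let t : UpperHalfPlane := ⟨s, hs'⟩
    have h1 : HasDerivAt (fun s : ℂ ↦ -1 / s) (1 / s ^ 2) s := by
      simpa [div_eq_mul_inv] using (hasDerivAt_inv h0).const_mul (-1)
    have hS : ((ModularGroup.S • t : UpperHalfPlane) : ℂ) = -1 / s := by
      rw [UpperHalfPlane.modular_S_smul]
      simp [t, inv_neg, neg_div]
    have h2 := hasDerivAt_divisorSeries_zero (ModularGroup.S • t)
    rw [hS] at h2
    have h3 := (((hasDerivAt_divisorSeries_zero t).sub (h2.comp s h1)).const_mul 2).sub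
      ((((hasDerivAt_id s).add (hasDerivAt_inv h0)).const_mul (Real.pi * I / 6)).add
        (Complex.hasDerivAt_log (Or.inr hs'.ne')))
    refine HasDerivAt.congr_deriv (f := H) h3 ?_
    -- The anomaly of `G2` under inversion accounts for the derivative of `log`.
    have hG := EisensteinSeries.G2_S_transform t
    rw [hG]
    have ht : (t : ℂ) = s := rfl
    rw [ht]
    have hpi : (Real.pi : ℂ) ≠ 0 := mod_cast Real.pi_ne_zero
    field_simp
    linear_combination (-72 * Real.pi * s) * I_sq
  -- The constant is read off at `I`, the fixed point of `s ↦ -1 / s`, where only `log I = πi / 2`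
  -- survives.
  have hc := hU.is_const_of_deriv_eq_zero hU' (f := H)
    (fun s hs ↦ (hd s hs).differentiableAt.differentiableWithinAt) (fun s hs ↦ (hd s hs).deriv)
    (x := τ) (y := I) hτ (by simp [U])
  have hI : -1 / I = I := by rw [neg_div, one_div, inv_I, neg_neg]
  simp only [H, hI, sub_self, mul_zero, inv_I, add_neg_cancel, zero_add, zero_sub, log_I] at hc
  linear_combination hc

theorem log_neg_conj {z : ℂ} (hz : 0 < z.im) :
    log (-conj z) = conj (log z) + Real.pi * I := by
  have h1 : (conj z).im < 0 := by simpa using hz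
  have h2 : z.arg ≠ Real.pi := fun h ↦ by
    rw [Complex.arg_eq_pi_iff] at h
    exact hz.ne' h.2
  rw [← Complex.log_conj _ h2, Complex.log, Complex.log, norm_neg,
    Complex.arg_neg_eq_arg_add_pi_of_im_neg h1]
  push_cast
  ring

/-! ### Bernoulli numbers as zeta values. -/

/-- Euler's formula; `u = 0` is included because `ζ(0) = -1/2`, so the end terms of the Bernoulli
sum need no special treatment. -/
theorem two_pi_I_pow_mul_bernoulli (u : ℕ) :
    (2 * (Real.pi : ℂ) * I) ^ (2 * u) *
      (((bernoulli (2 * u) : ℚ) : ℂ) / ((2 * u).factorial : ℂ)) = -2 * riemannZeta (2 * u) := by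
  rw [riemannZeta_two_mul_nat', mul_pow, mul_pow, pow_mul I, I_sq, zpow_sub₀ two_ne_zero]
  have h : (2 : ℂ) ^ (2 * (u : ℤ)) = 2 ^ (2 * u) := by norm_cast
  rw [h, zpow_one, pow_succ]
  field_simp

theorem two_pi_I_pow_mul_bernoulliSum (j : ℕ) (z : ℂ) :
    (2 * (Real.pi : ℂ) * I) ^ (1 - (-(2 * j : ℕ) : ℤ)) * bernoulliSum (-(2 * j : ℕ)) z =
      -2 * I / Real.pi * ∑ p ∈ antidiagonal (j + 1),
        riemannZeta (2 * (p.1 : ℂ)) * riemannZeta (2 * (p.2 : ℂ)) * z ^ (1 - 2 * (p.2 : ℤ)) := by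
  have hpi : (Real.pi : ℂ) ≠ 0 := mod_cast Real.pi_ne_zero
  have hp : pairsWithSum (1 - (-(2 * j : ℕ) : ℤ) / 2) = antidiagonal (j + 1) := by
    ext p
    rw [mem_pairsWithSum, Finset.HasAntidiagonal.mem_antidiagonal]
    lia
  rw [bernoulliSum, hp, Finset.mul_sum, Finset.mul_sum]
  refine Finset.sum_congr rfl fun p hpm ↦ ?_
  have hk : 1 - (-(2 * j : ℕ) : ℤ) = (2 * p.1 + 2 * p.2 : ℕ) - 1 := by
    have := Finset.HasAntidiagonal.mem_antidiagonal.mp hpm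
    lia
  have h1 := two_pi_I_pow_mul_bernoulli p.1
  have h2 := two_pi_I_pow_mul_bernoulli p.2
  have h0 : 2 * (Real.pi : ℂ) * I ≠ 0 := by simp [hpi]
  rw [hk, zpow_sub₀ h0, zpow_one, zpow_natCast, pow_add]
  calc _ = ((2 * (Real.pi : ℂ) * I) ^ (2 * p.1) *
        (((bernoulli (2 * p.1) : ℚ) : ℂ) / ((2 * p.1).factorial : ℂ))) *
        ((2 * (Real.pi : ℂ) * I) ^ (2 * p.2) *
        (((bernoulli (2 * p.2) : ℚ) : ℂ) / ((2 * p.2).factorial : ℂ))) *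
        (2 * (Real.pi : ℂ) * I)⁻¹ * z ^ (1 - 2 * (p.2 : ℤ)) := by ring
    _ = _ := by
      rw [h1, h2]
      field_simp
      linear_combination riemannZeta (2 * p.1) * riemannZeta (2 * p.2) *
        z ^ (1 - 2 * (p.2 : ℤ)) * I_sq

theorem neg_conj_neg_one_div (z : ℂ) : -conj (-1 / z) = -1 / -conj z := by
  simp [neg_div]

/-! ### The transformation law for negative weights. -/

theorem V_neg_sub_inversion (j : ℕ) {z : ℂ} (hz : 0 < z.im) :
    V (-(2 * (j + 1) : ℕ)) z - z ^ (2 * (j + 1)) * V (-(2 * (j + 1) : ℕ)) (-1 / z) =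
      -1 / 2 * riemannZeta (2 * (j + 1) + 1) * (1 - z ^ (2 * (j + 1))) +
      I / (2 * Real.pi) * (riemannZeta (2 * (j + 1) + 2) *
        (-z⁻¹ + z⁻¹ * (1 - z / conj z) ^ (2 * (j + 1) + 1) - z ^ (2 * (j + 1) + 1) +
          (z - conj z) ^ (2 * (j + 1) + 1)) +
        2 * ∑ a ∈ range (j + 1), z ^ (2 * a + 1) * (riemannZeta (2 * ((j + 1 - a : ℕ) : ℂ)) *
        riemannZeta (2 * ((a + 1 : ℕ) : ℂ)))) := by
  have hz0 : z ≠ 0 := by rintro rfl; simp at hz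
  have ha : 0 < (-conj z).im := by rwa [neg_conj_im]
  have ha0 : -conj z ≠ 0 := by simpa using hz0
  obtain ⟨q, hq, hqe⟩ := (isJet_divisorSeries (2 * (j + 1)) (neg_one_div_im_pos ha)).inversion ha0
  have hA : IsJet (2 * (j + 1)) (fun s : ℂ ↦ 1 - s ^ (2 * (j + 1))) (-conj z)
      (1 - Polynomial.X ^ (2 * (j + 1))) := by
    refine (IsJet.of_eval ?_).congr (Eventually.of_forall fun s ↦ by simp)
    exact (Polynomial.natDegree_sub_le_of_le (Polynomial.natDegree_one.le.trans (Nat.zero_le _))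
      (Polynomial.natDegree_X_pow _).le).trans_eq (max_self _)
  have hB : ∀ b ∈ range (j + 1), IsJet (2 * (j + 1)) (fun s : ℂ ↦ s ^ (2 * b + 1) *
      (riemannZeta (2 * ((j + 1 - b : ℕ) : ℂ)) * riemannZeta (2 * ((b + 1 : ℕ) : ℂ)))) (-conj z)
      (Polynomial.C (riemannZeta (2 * ((j + 1 - b : ℕ) : ℂ)) *
        riemannZeta (2 * ((b + 1 : ℕ) : ℂ))) * Polynomial.X ^ (2 * b + 1)) := fun b hb ↦ by
    refine (IsJet.of_eval ?_).congr (Eventually.of_forall fun s ↦ by simp [mul_comm])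
    have := Finset.mem_range.mp hb
    exact (Polynomial.natDegree_C_mul_X_pow_le _ _).trans (by lia)
  -- The jet of Ramanujan's formula at `-conj z`, solved for `divisorSeries` and assembled term by
  -- term.
  have hR := hq.add ((hA.const_mul (-1 / 2 * riemannZeta (2 * (j + 1) + 1))).add
    (((((IsJet.inv (2 * (j + 1)) ha0).add (IsJet.pow_succ (2 * (j + 1)) (-conj z))).const_mul
      (riemannZeta (2 * (j + 1) + 2))).add
      ((IsJet.sum (range (j + 1)) hB).const_mul (-2))).const_mul (I / (2 * Real.pi))))
  have hu := (isJet_divisorSeries (2 * (j + 1)) ha).unique (hR.congr (by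
    filter_upwards [(isOpen_lt continuous_const Complex.continuous_im).mem_nhds ha] with s hs
    have := divisorSeries_sub_inversion j (τ := s) hs
    linear_combination -this))
  have he := congrArg (Polynomial.eval (-z)) hu
  simp only [Polynomial.eval_add, Polynomial.eval_mul, Polynomial.eval_C, Polynomial.eval_sub,
    Polynomial.eval_pow, Polynomial.eval_X, Polynomial.eval_one, Polynomial.eval_finsetSum] at he
  -- The inverted jet is based at `-1 / (-conj z) = -conj (-1 / z)` and evaluated at `-1 / (-z) =
  -- -(-1 / z)`, so it is `V` at `-1 / z`.
  rw [← V_neg_natCast _ hz, hqe _ (neg_ne_zero.mpr hz0), eval_invJet _ ha0 (neg_ne_zero.mpr hz0),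
    ← neg_conj_neg_one_div, show -1 / -z = -(-1 / z) by ring,
    ← V_neg_natCast _ (neg_one_div_im_pos hz)] at he
  have hS : ∑ b ∈ range (j + 1), riemannZeta (2 * ((j + 1 - b : ℕ) : ℂ)) *
      riemannZeta (2 * ((b + 1 : ℕ) : ℂ)) * (-z) ^ (2 * b + 1) =
      -∑ a ∈ range (j + 1), z ^ (2 * a + 1) * (riemannZeta (2 * ((j + 1 - a : ℕ) : ℂ)) *
        riemannZeta (2 * ((a + 1 : ℕ) : ℂ))) := by
    rw [← Finset.sum_neg_distrib]
    refine Finset.sum_congr rfl fun a _ ↦ ?_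
    rw [(odd_two_mul_add_one a).neg_pow]
    ring
  have hw : Even (2 * (j + 1)) := even_two_mul _
  rw [hS, hw.neg_pow, hw.add_one.neg_pow, neg_div_neg_eq,
    show -z - -conj z = -(z - conj z) by ring, hw.add_one.neg_pow, inv_neg] at he
  linear_combination he

/-- The two end terms carry `ζ(0) = -1/2` and give `z⁻¹` and `z ^ (w + 1)` with `w = 2j + 2`; the
inner ones form the sum in Ramanujan's formula. -/
theorem sum_antidiagonal_zeta (j : ℕ) {z : ℂ} (hz : z ≠ 0) :
    ∑ p ∈ antidiagonal (j + 1 + 1), riemannZeta (2 * (p.1 : ℂ)) * riemannZeta (2 * (p.2 : ℂ)) *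
      z ^ (1 - 2 * (p.2 : ℤ)) = (z ^ (2 * (j + 1)))⁻¹ *
      (-1 / 2 * riemannZeta (2 * (j + 1) + 2) * (z⁻¹ + z ^ (2 * (j + 1) + 1)) +
        ∑ a ∈ range (j + 1), z ^ (2 * a + 1) * (riemannZeta (2 * ((j + 1 - a : ℕ) : ℂ)) *
        riemannZeta (2 * ((a + 1 : ℕ) : ℂ)))) := by
  rw [Finset.Nat.sum_antidiagonal_eq_sum_range_succ_mk, Finset.sum_range_succ,
    Finset.sum_range_succ', mul_add, Finset.mul_sum]
  have h : ∀ a ∈ range (j + 1), riemannZeta (2 * ((a + 1 : ℕ) : ℂ)) *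
      riemannZeta (2 * ((j + 1 + 1 - (a + 1) : ℕ) : ℂ)) *
      z ^ (1 - 2 * ((j + 1 + 1 - (a + 1) : ℕ) : ℤ)) = (z ^ (2 * (j + 1)))⁻¹ * (z ^ (2 * a + 1) *
        (riemannZeta (2 * ((j + 1 - a : ℕ) : ℂ)) * riemannZeta (2 * ((a + 1 : ℕ) : ℂ)))) := by
    intro a ha
    have ha' := Finset.mem_range.mp ha
    rw [show 1 - 2 * ((j + 1 + 1 - (a + 1) : ℕ) : ℤ) = (2 * a + 1 : ℕ) - (2 * (j + 1) : ℕ) by lia,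
      zpow_sub₀ hz, zpow_natCast, zpow_natCast, Nat.add_sub_add_right]
    ring
  rw [Finset.sum_congr rfl h]
  rw [show j + 1 + 1 - 0 = j + 2 by lia, Nat.sub_self,
    show (1 : ℤ) - 2 * ((j + 2 : ℕ) : ℤ) = -(2 * (j + 1) + 1 : ℕ) by push_cast; ring, zpow_neg,
    zpow_natCast]
  have h2 : (2 : ℂ) * ((j + 2 : ℕ) : ℂ) = 2 * (j + 1) + 2 := by push_cast; ring
  rw [h2]
  simp only [Nat.cast_zero, mul_zero, riemannZeta_zero, sub_zero, zpow_one]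
  field_simp
  ring

/-! ### Positive weights, weight zero and the final assembly. -/

theorem VTerm_of_pos {k : ℤ} (hk : 0 < k) (z : ℂ) (m : ℕ) : VTerm k z m = 0 := by
  rw [VTerm, show (1 - k).toNat = 0 by lia]
  simp

theorem ofReal_im_eq (z : ℂ) : (z.im : ℂ) = (z - conj z) / (2 * I) := by
  rw [Complex.sub_conj]
  push_cast
  field_simp

/-- For `k ≥ 4`, `2 - k` is a trivial zero of zeta and the Bernoulli sum is empty. For `k = 2` the
pair `(0, 0)` cancels the `ζ(0)` term. -/
theorem V_inversion_of_pos {k : ℤ} (hk : Even k) (hk0 : 0 < k) {z : ℂ} (hz : 0 < z.im) :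
    2 * riemannZeta (2 - (k : ℂ)) / (2 * (Real.pi : ℂ) * I) ^ k *
      ((z.im : ℂ) / (Real.pi : ℂ)) ^ (1 - k) * ((‖z‖ : ℂ) ^ (2 * k - 2) - z ^ k) -
      (2 * (Real.pi : ℂ) * I) ^ (1 - k) * bernoulliSum k z = 0 := by
  obtain ⟨r, rfl⟩ := hk
  have hpi : (Real.pi : ℂ) ≠ 0 := mod_cast Real.pi_ne_zero
  obtain h | h := eq_or_ne r 1
  · subst h
    have hz0 : z ≠ 0 := by rintro rfl; simp at hz
    have hy : (z.im : ℂ) ≠ 0 := mod_cast hz.ne'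
    have hp : pairsWithSum (1 - (1 + 1) / 2) = {(0, 0)} := by
      ext p
      rw [mem_pairsWithSum, Finset.mem_singleton, Prod.ext_iff]
      simp only
      lia
    have hn : (‖z‖ : ℂ) ^ 2 = z * conj z := by rw [Complex.mul_conj, Complex.normSq_eq_norm_sq]; simp
    rw [bernoulliSum, hp, Finset.sum_singleton]
    norm_num [riemannZeta_zero]
    rw [hn]
    have hc : z - conj z = 2 * z.im * I := by rw [Complex.sub_conj]; push_cast; ring
    field_simp
    linear_combination z * hc + 2 * z * z.im * I * I_sq
  · obtain ⟨n, rfl⟩ : ∃ n : ℕ, r = n + 2 := ⟨(r - 2).toNat, by lia⟩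
    have hp : pairsWithSum (1 - ((n + 2 : ℤ) + (n + 2)) / 2) = ∅ := by
      ext p
      rw [mem_pairsWithSum]
      simp only [Finset.notMem_empty, iff_false]
      lia
    rw [bernoulliSum, hp, Finset.sum_empty, show (2 : ℂ) - (((n + 2 : ℤ) + (n + 2) : ℤ) : ℂ) =
      -2 * ((n : ℂ) + 1) by push_cast; ring, riemannZeta_neg_two_mul_nat_add_one]
    simp

theorem V_inversion_zero {z : ℂ} (hz : 0 < z.im) :
    2 * (V 0 z - V 0 (-1 / z)) = Real.pi * I / 2 + conj (log z) -
      Real.pi * I / 6 * (conj z + (conj z)⁻¹) := by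
  -- A jet of degree zero is just the value at the base point.
  have hV : ∀ {z : ℂ}, 0 < z.im → V 0 z = divisorSeries 0 (-conj z) := fun {z} hz ↦ by
    have h := V_neg_natCast 0 hz
    rw [eval_divisorSeriesJet 0 (by rwa [neg_conj_im])] at h
    simpa [divisorSeries] using h
  rw [hV hz, hV (neg_one_div_im_pos hz), neg_conj_neg_one_div,
    divisorSeries_zero_sub_inversion (by rwa [neg_conj_im]), log_neg_conj hz, inv_neg]
  ring

theorem theorem1p3 (k : ℤ) (hk : Even k) (z : ℂ) (hz : 0 < z.im) :
    Summable (fun m : ℕ => VTerm k z (m + 1)) ∧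
    Summable (fun m : ℕ => VTerm k (-1 / z) (m + 1)) ∧
    2 * (z ^ k * V k z - V k (-1 / z)) =
      2 * riemannZeta (2 - (k : ℂ)) / (2 * (Real.pi : ℂ) * Complex.I) ^ k *
          ((z.im : ℂ) / (Real.pi : ℂ)) ^ (1 - k) *
          ((‖z‖ : ℂ) ^ (2 * k - 2) - z ^ k)
        - (2 * (Real.pi : ℂ) * Complex.I) ^ (1 - k) * bernoulliSum k z
        + (if 0 < k then 0
           else if k = 0 then (Real.pi : ℂ) * Complex.I / 2 + conj (Complex.log z)
           else (1 - z ^ k) * riemannZeta (1 - (k : ℂ))) := by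
  have hpi : (Real.pi : ℂ) ≠ 0 := mod_cast Real.pi_ne_zero
  have hz0 : z ≠ 0 := by rintro rfl; simp at hz
  have hc0 : conj z ≠ 0 := by simpa using hz0
  have hn : (‖z‖ : ℂ) ^ 2 = z * conj z := by rw [Complex.mul_conj, Complex.normSq_eq_norm_sq]; simp
  rcases lt_or_ge 0 k with hk0 | hk0
  · simp only [V, VTerm_of_pos hk0, summable_zero, tsum_zero, true_and, if_pos hk0]
    rw [V_inversion_of_pos hk hk0 hz]
    ring
  obtain ⟨w, rfl⟩ : ∃ w : ℕ, k = -w := ⟨k.natAbs, by lia⟩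
  refine ⟨summable_VTerm_neg_natCast w hz, summable_VTerm_neg_natCast w (neg_one_div_im_pos hz), ?_⟩
  obtain ⟨n, rfl⟩ : ∃ n : ℕ, w = 2 * n := by
    obtain ⟨r, hr⟩ := hk
    exact ⟨(-r).toNat, by lia⟩
  rw [two_pi_I_pow_mul_bernoulliSum, if_neg (not_lt.mpr hk0)]
  rcases n with _ | j
  · have h := V_inversion_zero hz
    rw [Finset.Nat.sum_antidiagonal_eq_sum_range_succ_mk]
    have hs : (‖z‖ : ℂ) ^ (-2 : ℤ) = (z * conj z)⁻¹ := by
      rw [← hn, zpow_neg]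
      norm_cast
    simp [Finset.sum_range_succ, riemannZeta_zero, riemannZeta_two, h, hs]
    rw [ofReal_im_eq]
    field_simp
    linear_combination Real.pi * (2 * conj z + 2 * conj z * z ^ 2 - 2 * conj z ^ 2 * z - 2 * z) *
      I_sq
  · have h := V_neg_sub_inversion j hz
    have h1 : (2 : ℂ) - ((-(2 * (j + 1) : ℕ) : ℤ) : ℂ) = 2 * (j + 1) + 2 := by push_cast; ring
    have h2 : (1 : ℂ) - ((-(2 * (j + 1) : ℕ) : ℤ) : ℂ) = 2 * (j + 1) + 1 := by push_cast; ring
    have h3 : (1 : ℤ) - (-(2 * (j + 1) : ℕ)) = (2 * (j + 1) + 1 : ℕ) := by push_cast; ring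
    have h4 : (‖z‖ : ℂ) ^ (2 * (-(2 * (j + 1) : ℕ) : ℤ) - 2) =
        ((z * conj z) ^ (2 * (j + 1) + 1))⁻¹ := by
      rw [← hn, ← pow_mul, ← zpow_natCast, ← zpow_neg]
      congr 1
    -- Uses `2iy = z - conj z`, matching the two jet remainders.
    have h5 : (2 * (Real.pi : ℂ) * I) ^ (2 * (j + 1)) * ((z.im : ℂ) / Real.pi) ^
        (2 * (j + 1) + 1) = (z - conj z) ^ (2 * (j + 1) + 1) / (2 * Real.pi * I) := by
      rw [eq_div_iff (by simp [hpi]), mul_right_comm, ← pow_succ, ← mul_pow, Complex.sub_conj]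
      congr 1
      push_cast
      field_simp
    have h6 : (1 - z / conj z) ^ (2 * (j + 1) + 1) =
        -((z - conj z) ^ (2 * (j + 1) + 1) / conj z ^ (2 * (j + 1) + 1)) := by
      rw [← div_pow, ← (even_two_mul (j + 1)).add_one.neg_pow]
      congr 1
      field_simp
      ring
    rw [if_neg (by lia), sum_antidiagonal_zeta j hz0, h1, h2, h3, h4, zpow_neg, zpow_neg,
      zpow_natCast, zpow_natCast, zpow_natCast, div_inv_eq_mul]
    rw [h6] at h
    generalize ∑ a ∈ range (j + 1), z ^ (2 * a + 1) * (riemannZeta (2 * ((j + 1 - a : ℕ) : ℂ)) *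
        riemannZeta (2 * ((a + 1 : ℕ) : ℂ))) = S at h ⊢
    generalize riemannZeta (2 * (j + 1) + 2) = A at h ⊢
    generalize riemannZeta (2 * (j + 1) + 1) = B at h ⊢
    rw [mul_assoc (2 * A), h5]
    have h7 : 2 * ((z ^ (2 * (j + 1)))⁻¹ * V (-(2 * (j + 1) : ℕ)) z -
        V (-(2 * (j + 1) : ℕ)) (-1 / z)) = 2 * (z ^ (2 * (j + 1)))⁻¹ *
        (V (-(2 * (j + 1) : ℕ)) z - z ^ (2 * (j + 1)) * V (-(2 * (j + 1) : ℕ)) (-1 / z)) := by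
      field_simp
    rw [h7, h, mul_pow]
    -- With the powers made opaque, a rational identity modulo `I ^ 2 = -1` remains.
    generalize (z - conj z) ^ (2 * (j + 1) + 1) = D
    rw [pow_succ z, pow_succ (conj z)]
    have hzw := pow_ne_zero (2 * (j + 1)) hz0
    have hcw := pow_ne_zero (2 * (j + 1)) hc0
    generalize z ^ (2 * (j + 1)) = Z at hzw ⊢
    generalize conj z ^ (2 * (j + 1)) = C at hcw ⊢
    field_simp
    linear_combination (z * C * conj z * A * D - A * D) * I_sq
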